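/- Let $p$ be a prime and let $G$ be a just-infinite $p$-group: that is, $G$ is infinite, every quotient $G/N$ by a nontrivial normal subgroup $N$ is finite, and every element of $G$ has order a power of $p$. Put $$S(G)=\{x\in G : x^{|G:H|}\in H \text{ for every subgroup } H\le G \text{ of finite index}\},$$ $$B(G)=\{x\in G : \langle x\rangle \text{ is subnormal in } G\}$$ ($B(G)$ is the Baer radical of $G$). Then $S(G)=G$ but $B(G)=\{1\}$. Moreover, let $K\le G$ be any nontrivial nilpotent subgroup (for example, any nontrivial cyclic subgroup), and for $H\le G$ of finite index let $|HK:H|$ denote the number of cosets of $H$ in $G$ that are intersected by $K$. Then $|HK:H|$ divides $|G:H|$ for every subgroup $H\le G$ of finite index, and yet $K$ is not subnormal in $G$. -/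

import Mathlib

/-- An infinite group is just-infinite if every proper quotient (that is, every quotient by a
nontrivial normal subgroup) is finite. -/
def IsJustInfinite (G : Type*) [Group G] : Prop :=
  Infinite G ∧ ∀ N : Subgroup G, N.Normal → N ≠ ⊥ → Finite (G ⧸ N)

/-- `S(G)`: the set of all `x` such that `x ^ |G : H| ∈ H` for every subgroup `H` of finite
index in `G`. -/
def sSet (G : Type*) [Group G] : Set G :=
  {x | ∀ H : Subgroup G, H.FiniteIndex → x ^ H.index ∈ H}

/-- The Baer radical `B(G)`: the set of all `x` such that the cyclic subgroup generated by `x`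
is subnormal in `G`. -/
def baerRadical (G : Type*) [Group G] : Set G :=
  {x | (Subgroup.zpowers x).IsSubnormal}

/-- `|HK : H|`: the number of cosets of `H` in `G` that are intersected by `K`.
It is only used for `H` of finite index, where this set of cosets is finite. -/
noncomputable def prodIndex {G : Type*} [Group G] (H K : Subgroup G) : ℕ :=
  Set.ncard {c : G ⧸ H | ∃ k ∈ K, (QuotientGroup.mk k : G ⧸ H) = c}

/-!
The divisibility statements hold in every `p`-group: the cosets of `H` met by `K` form an orbit of
`K` on `G ⧸ H`, so their number is the relative index of `H` in `K`. It is a power of `p`, at most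
the power of `p` that is `|G : H|`, and hence divides it. For `K = ⟨x⟩` it is moreover an exponent
that carries `x` into `H`.

For the absence of nilpotent subnormal subgroups, only three properties of `G` matter: it is
infinite and torsion, and its nontrivial normal subgroups have finite index.

* `G` has no nontrivial abelian normal subgroup `A`: the normal closure of an element of `A` is
  generated by finitely many elements (`A` is of finite index and centralizes `A`), hence would be
  a finite subgroup of finite index.
* A normal subgroup `N` of finite index has no nontrivial abelian normal subgroup `E`
  (`IsJustInfinite.eq_bot_of_le_normalizer_of_le_centralizer`): a maximal nontrivial intersection
  of conjugates of `E` is central in the normal closure of `E` in `G`.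
* If `K` is normal in such an `N`, then `K C_N(K)` has finite index
  (`IsJustInfinite.finiteIndex_sup_centralizer_inf`): it meets every nontrivial normal subgroup of
  `N`, hence so does the intersection of its finitely many conjugates, which is then a nontrivial
  normal subgroup of `G`.
* By induction along a subnormal series, a subnormal subgroup `A` has finitely many conjugates
  (`IsJustInfinite.finiteIndex_normalizer_and_sup_centralizer`). The induction carries along that
  `A C_G(A)` has finite index.

If `K` is nilpotent and subnormal, and `N` is the normal core of its normalizer, then `Z(K) ∩ N` is
an abelian normal subgroup of `N`, hence trivial. So `N` centralizes `Z(K)`, and a nontrivial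
element of `Z(K)` would have a centralizer of finite index. This is impossible by
`IsJustInfinite.eq_one_of_finiteIndex_centralizer`.
-/

open Subgroup

/-! ### Subgroups normalizing each other, and finite families of conjugates -/

/-- Two subgroups that normalize each other and meet trivially commute. -/
lemma Subgroup.le_centralizer_of_le_normalizer_of_inf_eq_bot {G : Type*} [Group G]
    {E F : Subgroup G} (hE : E ≤ normalizer (F : Set G)) (hF : F ≤ normalizer (E : Set G))
    (h : E ⊓ F = ⊥) : E ≤ centralizer (F : Set G) := by
  rw [le_normalizer_iff] at hE hF
  intro e he
  rw [mem_centralizer_iff]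
  intro f hf
  have h1 : f * e * f⁻¹ * e⁻¹ ∈ E ⊓ F := by
    refine ⟨E.mul_mem (hF f hf e he) (E.inv_mem he), ?_⟩
    have := F.mul_mem hf (hE e he _ (F.inv_mem hf))
    simpa [mul_assoc] using this
  rw [h, mem_bot] at h1
  rwa [mul_inv_eq_one, mul_inv_eq_iff_eq_mul] at h1

lemma Subgroup.conj_mem_centralizer {G : Type*} [Group G] {K : Subgroup G} {n c : G}
    (hn : n ∈ normalizer (K : Set G)) (hc : c ∈ centralizer (K : Set G)) :
    n * c * n⁻¹ ∈ centralizer (K : Set G) := by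
  rw [mem_centralizer_iff]
  intro k hk
  have h1 := mem_centralizer_iff.1 hc _ ((mem_normalizer_iff''.1 hn k).1 hk)
  have h2 := congrArg (fun x => n * x * n⁻¹) h1
  simpa [mul_assoc] using h2

lemma Subgroup.finite_range_of_finiteIndex {G α : Type*} [Group G] (f : G → α) (H : Subgroup G)
    [H.FiniteIndex] (hf : ∀ g, ∀ h ∈ H, f (g * h) = f g) : (Set.range f).Finite := by
  refine (Set.finite_range fun c : G ⧸ H => f c.out).subset ?_
  rintro _ ⟨g, rfl⟩
  obtain ⟨h, hh⟩ := QuotientGroup.mk_out_eq_mul H g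
  exact ⟨(g : G ⧸ H), by simpa [hh] using hf g h h.2⟩

lemma Subgroup.mem_map_conj_iff {G : Type*} [Group G] {K : Subgroup G} {g x : G} :
    x ∈ K.map (MulAut.conj g).toMonoidHom ↔ g⁻¹ * x * g ∈ K := by
  constructor
  · rintro ⟨y, hy, rfl⟩
    simpa [mul_assoc] using hy
  · intro h
    exact ⟨_, h, by simp [mul_assoc]⟩

lemma Subgroup.finite_range_map_conj {G : Type*} [Group G] (K N : Subgroup G) [N.FiniteIndex]
    (h : N ≤ normalizer (K : Set G)) :
    (Set.range fun g : G => K.map (MulAut.conj g).toMonoidHom).Finite := by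
  refine finite_range_of_finiteIndex _ N fun g n hn => ?_
  ext x
  rw [mem_map_conj_iff, mem_map_conj_iff, mem_normalizer_iff.1 (h hn)]
  simp [mul_assoc]

lemma Subgroup.le_normalizer_map_conj {G : Type*} [Group G] {K N : Subgroup G} [hN : N.Normal]
    (h : N ≤ normalizer (K : Set G)) (g : G) :
    N ≤ normalizer (K.map (MulAut.conj g).toMonoidHom : Set G) := by
  rw [le_normalizer_iff] at h ⊢
  intro n hn k hk
  rw [mem_map_conj_iff] at hk ⊢
  have := h _ (by simpa using hN.conj_mem n hn g⁻¹) _ hk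
  simpa [mul_assoc] using this

lemma Subgroup.le_normalizer_inf_sInf {G : Type*} [Group G] {N : Subgroup G} [hN : N.Normal]
    {S : Set (Subgroup G)} (h : ∀ L ∈ S, N ≤ normalizer (L : Set G)) :
    N ≤ normalizer ((N ⊓ sInf S : Subgroup G) : Set G) := by
  rw [le_normalizer_iff]
  intro n hn k hk
  refine ⟨hN.conj_mem k hk.1 n, mem_sInf.2 fun L hL => ?_⟩
  exact le_normalizer_iff.1 (h L hL) n hn k (mem_sInf.1 hk.2 L hL)

/-! ### Abelian normal subgroups in just-infinite torsion groups -/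

section JustInfinite

variable {G : Type*} [Group G]

lemma IsJustInfinite.finiteIndex (hJ : IsJustInfinite G) {N : Subgroup G} (hN : N.Normal)
    (h : N ≠ ⊥) : N.FiniteIndex :=
  have := hJ.2 N hN h
  N.finiteIndex_of_finite_quotient

lemma IsJustInfinite.ne_bot_of_finiteIndex (hJ : IsJustInfinite G) (N : Subgroup G)
    [hN : N.FiniteIndex] : N ≠ ⊥ := by
  rintro rfl
  exact not_finite_iff_infinite.2 hJ.1 (finite_iff_finite_and_finiteIndex (H := ⊥) |>.2
    ⟨inferInstance, hN⟩)

lemma IsJustInfinite.eq_bot_of_normal_of_le_centralizer (hJ : IsJustInfinite G)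
    (ht : IsMulTorsion G) {A : Subgroup G} (hA : A.Normal) (hc : A ≤ centralizer (A : Set G)) :
    A = ⊥ := by
  by_contra hne
  obtain ⟨a, ha, ha1⟩ := A.bot_or_exists_ne_one.resolve_left hne
  have := hJ.finiteIndex hA hne
  have hfin : (Set.range fun g : G => g * a * g⁻¹).Finite := by
    refine finite_range_of_finiteIndex _ A fun g h hh => ?_
    have := mem_centralizer_iff.1 (hc hh) a ha
    rw [mul_assoc g h a, ← this]
    group
  have hM : normalClosure {a} ≤ A := normalClosure_le_normal (by simpa using ha)
  have hfg : (normalClosure {a}).FG := by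
    refine (fg_iff _).2 ⟨_, ?_, hfin⟩
    rw [normalClosure]
    congr 1
    ext x
    simp [Group.mem_conjugatesOfSet_iff, isConj_iff]
  have : IsMulCommutative (normalClosure {a}) :=
    le_centralizer_iff_isMulCommutative.1 (hM.trans (hc.trans (centralizer_le hM)))
  have : Group.FG (normalClosure {a}) := (Group.fg_iff_subgroup_fg _).2 hfg
  have hfinM : Finite (normalClosure {a}) := by
    open scoped IsMulCommutative in
    exact CommGroup.finite_of_fg_isMulTorsion _ (ht.subgroup _)
  have hMne : normalClosure {a} ≠ ⊥ := by
    intro h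
    exact ha1 (by simpa [h] using subset_normalClosure (Set.mem_singleton a))
  exact not_finite_iff_infinite.2 hJ.1 ((finite_iff_finite_and_finiteIndex _).2
    ⟨hfinM, hJ.finiteIndex normalClosure_normal hMne⟩)

/-- In a just-infinite torsion group, a normal subgroup `N` of finite index has no nontrivial
abelian normal subgroup. -/
lemma IsJustInfinite.eq_bot_of_le_normalizer_of_le_centralizer (hJ : IsJustInfinite G)
    (ht : IsMulTorsion G) {N E : Subgroup G} [N.Normal] [N.FiniteIndex] (hEN : E ≤ N)
    (hNE : N ≤ normalizer (E : Set G)) (hc : E ≤ centralizer (E : Set G)) : E = ⊥ := by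
  by_contra hne
  set O : Set (Subgroup G) := Set.range fun g : G => E.map (MulAut.conj g).toMonoidHom
  have hOfin : O.Finite := finite_range_map_conj E N hNE
  have hON : ∀ L ∈ O, N ≤ normalizer (L : Set G) := by
    rintro _ ⟨g, rfl⟩
    exact le_normalizer_map_conj hNE g
  have hEO : E ∈ O := ⟨1, by ext; simp⟩
  -- `D` below is the intersection over a maximal set `S ∋ E` of conjugates meeting nontrivially.
  obtain ⟨S, -, hS⟩ := (hOfin.finite_subsets.subset
    (t := {S | S ⊆ O ∧ E ∈ S ∧ N ⊓ sInf S ≠ ⊥}) fun S hS => hS.1).exists_le_maximal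
    (a := {E}) ⟨by simpa using hEO, rfl, by simpa [inf_eq_right.2 hEN] using hne⟩
  obtain ⟨hSO, hE, hD⟩ := hS.prop
  set D := N ⊓ sInf S
  have hND : N ≤ normalizer (D : Set G) := le_normalizer_inf_sInf fun L hL => hON L (hSO hL)
  have hDL : ∀ L ∈ O, D ≤ centralizer (L : Set G) := by
    intro L hL
    by_cases hLS : L ∈ S
    · have hLc : L ≤ centralizer (L : Set G) := by
        obtain ⟨g, rfl⟩ := hL
        intro x hx
        rw [mem_centralizer_iff]
        intro y hy
        rw [SetLike.mem_coe, mem_map_conj_iff] at hy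
        rw [mem_map_conj_iff] at hx
        have h1 := mem_centralizer_iff.1 (hc hx) _ hy
        have h2 := congrArg (fun x => g * x * g⁻¹) h1
        simpa [mul_assoc] using h2
      exact (inf_le_right.trans (sInf_le hLS)).trans hLc
    · have hLN : L ≤ N := by
        obtain ⟨g, rfl⟩ := hL
        rintro _ ⟨y, hy, rfl⟩
        exact ‹N.Normal›.conj_mem y (hEN hy) g
      have hDL : D ⊓ L = ⊥ := by
        by_contra hDL
        refine hLS (hS.le_of_ge (y := insert L S) ⟨?_, Or.inr hE, ?_⟩ (Set.subset_insert _ _)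
          (Set.mem_insert _ _))
        · exact Set.insert_subset hL hSO
        · rwa [sInf_insert, inf_comm L, ← inf_assoc]
      exact le_centralizer_of_le_normalizer_of_inf_eq_bot (inf_le_left.trans (hON L hL))
        (hLN.trans hND) hDL
  have hDM : D ≤ centralizer (normalClosure (E : Set G) : Set G) := by
    intro d hd
    rw [normalClosure, centralizer_closure, mem_centralizer_iff]
    intro x hx
    obtain ⟨e, he, hex⟩ := Group.mem_conjugatesOfSet_iff.1 hx
    obtain ⟨g, rfl⟩ := isConj_iff.1 hex
    exact mem_centralizer_iff.1 (hDL _ ⟨g, rfl⟩ hd) _ ⟨e, he, rfl⟩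
  refine hD (le_bot_iff.1 ?_)
  rw [← hJ.eq_bot_of_normal_of_le_centralizer ht
    (A := normalClosure (E : Set G) ⊓ centralizer (normalClosure (E : Set G) : Set G))
    inferInstance (inf_le_right.trans (centralizer_le inf_le_left))]
  exact le_inf ((inf_le_right.trans (sInf_le hE)).trans le_normalClosure) hDM

/-- A just-infinite torsion group has trivial FC-centre. -/
lemma IsJustInfinite.eq_one_of_finiteIndex_centralizer (hJ : IsJustInfinite G)
    (ht : IsMulTorsion G) {a : G} (ha : (centralizer {a}).FiniteIndex) : a = 1 := by
  by_contra ha1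
  set N := (centralizer {a}).normalCore
  set M := normalClosure {a}
  have hMne : M ≠ ⊥ := by
    intro h
    exact ha1 (by simpa [M, h] using subset_normalClosure (Set.mem_singleton a))
  have hMN : N ≤ centralizer (M : Set G) := by
    rw [le_centralizer_iff]
    refine normalClosure_le_normal ?_
    rw [Set.singleton_subset_iff, SetLike.mem_coe, mem_centralizer_iff]
    intro n hn
    exact (mem_centralizer_iff.1 (normalCore_le _ hn) a rfl).symm
  have := hJ.finiteIndex (N := M) normalClosure_normal hMne
  refine hJ.ne_bot_of_finiteIndex (M ⊓ N) (hJ.eq_bot_of_normal_of_le_centralizer ht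
    inferInstance (inf_le_right.trans (hMN.trans (centralizer_le inf_le_left))))

/-! ### Subnormal subgroups of just-infinite torsion groups -/

/-- If `K` is normal in the finite-index normal subgroup `N`, then `K C_N(K)` has finite index. -/
lemma IsJustInfinite.finiteIndex_sup_centralizer_inf (hJ : IsJustInfinite G)
    {N K : Subgroup G} [hN : N.Normal] [N.FiniteIndex] (hKN : K ≤ N)
    (hNK : N ≤ normalizer (K : Set G)) :
    (K ⊔ (centralizer (K : Set G) ⊓ N)).FiniteIndex := by
  set P := K ⊔ (centralizer (K : Set G) ⊓ N) with hP
  have hNP : N ≤ normalizer (P : Set G) := by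
    have hC : N ≤ normalizer ((centralizer (K : Set G) ⊓ N : Subgroup G) : Set G) := by
      rw [le_normalizer_iff]
      exact fun n hn c hc => ⟨conj_mem_centralizer (hNK hn) hc.1, hN.conj_mem c hc.2 n⟩
    intro n hn
    rw [mem_normalizer_iff_map_conj_eq, hP, Subgroup.map_sup,
      mem_normalizer_iff_map_conj_eq.1 (hNK hn), mem_normalizer_iff_map_conj_eq.1 (hC hn)]
  set O : Set (Subgroup G) := Set.range fun g : G => P.map (MulAut.conj g).toMonoidHom
  have hOfin : O.Finite := finite_range_map_conj P N hNP
  have hON : ∀ L ∈ O, N ≤ normalizer (L : Set G) := by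
    rintro _ ⟨g, rfl⟩
    exact le_normalizer_map_conj hNP g
  -- Every conjugate of `P` meets every nontrivial normal subgroup of `N`.
  have hess : ∀ L ∈ O, ∀ E ≤ N, N ≤ normalizer (E : Set G) → E ⊓ L = ⊥ → E = ⊥ := by
    rintro _ ⟨g, rfl⟩ E hEN hNE h
    set K' := K.map (MulAut.conj g).toMonoidHom
    have hK'N : K' ≤ N := by
      rintro _ ⟨y, hy, rfl⟩
      exact hN.conj_mem y (hKN hy) g
    have hEK : E ≤ centralizer (K' : Set G) := by
      refine le_centralizer_of_le_normalizer_of_inf_eq_bot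
        (hEN.trans (le_normalizer_map_conj hNK g)) (hK'N.trans hNE) (le_bot_iff.1 ?_)
      exact (inf_le_inf_left E (map_mono le_sup_left)).trans h.le
    have hEL : E ≤ P.map (MulAut.conj g).toMonoidHom := by
      intro e he
      rw [mem_map_conj_iff]
      refine (le_sup_right : _ ≤ P) ⟨?_, by simpa using hN.conj_mem e (hEN he) g⁻¹⟩
      refine mem_centralizer_iff.2 fun k hk => ?_
      have h2 := mem_centralizer_iff.1 (hEK he) _ ⟨k, hk, rfl⟩
      have h3 := congrArg (fun x => g⁻¹ * x * g) h2
      simpa [mul_assoc] using h3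
    rwa [inf_eq_left.2 hEL] at h
  have hne : N ⊓ sInf O ≠ ⊥ := by
    refine Set.Finite.induction_on_subset (motive := fun S _ => N ⊓ sInf S ≠ ⊥) O hOfin ?_ ?_
    · simpa using hJ.ne_bot_of_finiteIndex N
    · intro L S hL hS _ ih h
      refine ih (hess L hL _ inf_le_left (le_normalizer_inf_sInf fun L hL => hON L (hS hL)) ?_)
      rwa [sInf_insert, inf_comm L, ← inf_assoc] at h
  have hcore : N ⊓ sInf O ≤ P.normalCore := by
    intro x hx g
    have := mem_sInf.1 hx.2 _ ⟨g⁻¹, rfl⟩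
    rw [mem_map_conj_iff] at this
    simpa using this
  have := hJ.finiteIndex P.normalCore_normal (ne_bot_of_le_ne_bot hne hcore)
  exact finiteIndex_of_le P.normalCore_le

/-- A subnormal subgroup `A` of a just-infinite torsion group has finitely many conjugates. The
second conclusion, on `A C_G(A)`, is what makes the induction along a subnormal series work: if `H`
is normal in `K`, then `K C_G(K)` normalizes `H`. -/
lemma IsJustInfinite.finiteIndex_normalizer_and_sup_centralizer (hJ : IsJustInfinite G)
    (ht : IsMulTorsion G) {A : Subgroup G} (hA : A.IsSubnormal) :
    (normalizer (A : Set G)).FiniteIndex ∧ (A ⊔ centralizer (A : Set G)).FiniteIndex := by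
  induction hA with
  | top =>
    refine ⟨finiteIndex_of_le (H := ⊤) ?_, finiteIndex_of_le (H := ⊤) le_sup_left⟩
    exact le_normalizer
  | step H K hHK _ hn ih =>
    rw [normal_subgroupOf_iff_le_normalizer hHK] at hn
    have := ih.2
    have hnorm : (normalizer (H : Set G)).FiniteIndex :=
      finiteIndex_of_le (H := K ⊔ centralizer (K : Set G))
        (sup_le hn ((centralizer_le hHK).trans (centralizer_le_normalizer _)))
    refine ⟨hnorm, ?_⟩
    set N := (normalizer (H : Set G)).normalCore
    have hNn : N.Normal := normalCore_normal _
    have hNH : N ≤ normalizer (H : Set G) := normalCore_le _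
    have hNK : N ≤ normalizer ((H ⊓ N : Subgroup G) : Set G) := by
      rw [le_normalizer_iff] at hNH ⊢
      exact fun n hn h hh => ⟨hNH n hn h hh.1, hNn.conj_mem h hh.2 n⟩
    have hHK' : H ≤ normalizer ((H ⊓ N : Subgroup G) : Set G) := by
      rw [le_normalizer_iff]
      exact fun a ha h hh => ⟨H.mul_mem (H.mul_mem ha hh.1) (H.inv_mem ha),
        hNn.conj_mem h hh.2 a⟩
    set C := centralizer ((H ⊓ N : Subgroup G) : Set G)
    have hZ : (H ⊓ N) ⊓ C = ⊥ := by
      refine hJ.eq_bot_of_le_normalizer_of_le_centralizer ht (N := N)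
        (inf_le_left.trans inf_le_right) ?_ (inf_le_right.trans (centralizer_le inf_le_left))
      rw [le_normalizer_iff]
      exact fun n hn h hh =>
        ⟨le_normalizer_iff.1 hNK n hn h hh.1, conj_mem_centralizer (hNK hn) hh.2⟩
    -- Commutators of `H` with `C_N(H ⊓ N)` lie in the centre of `H ⊓ N`, which is trivial.
    have hCH : C ⊓ N ≤ centralizer (H : Set G) := by
      intro c hc
      rw [mem_centralizer_iff]
      intro a ha
      have h1 : a * c * a⁻¹ * c⁻¹ ∈ (H ⊓ N) ⊓ C := by
        refine ⟨⟨?_, ?_⟩, ?_⟩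
        · have := H.mul_mem ha (le_normalizer_iff.1 hNH c hc.2 _ (H.inv_mem ha))
          simpa [mul_assoc] using this
        · exact N.mul_mem (hNn.conj_mem c hc.2 a) (N.inv_mem hc.2)
        · exact C.mul_mem (conj_mem_centralizer (hHK' ha) hc.1) (C.inv_mem hc.1)
      rw [hZ, mem_bot] at h1
      rwa [mul_inv_eq_one, mul_inv_eq_iff_eq_mul] at h1
    have := hJ.finiteIndex_sup_centralizer_inf (N := N) (K := H ⊓ N) inf_le_right hNK
    exact finiteIndex_of_le (H := H ⊓ N ⊔ C ⊓ N) (sup_le_sup inf_le_left hCH)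

lemma IsJustInfinite.not_isSubnormal_of_isNilpotent (hJ : IsJustInfinite G)
    (ht : IsMulTorsion G) {K : Subgroup G} (hK : K ≠ ⊥) (hnil : Group.IsNilpotent K) :
    ¬ K.IsSubnormal := by
  intro hs
  have := (hJ.finiteIndex_normalizer_and_sup_centralizer ht hs).1
  set N := (normalizer (K : Set G)).normalCore
  have hNn : N.Normal := normalCore_normal _
  have hNK : N ≤ normalizer (K : Set G) := normalCore_le _
  set Z := K ⊓ centralizer (K : Set G)
  have hNZ : ∀ n ∈ N, ∀ z ∈ Z, n * z * n⁻¹ ∈ Z := by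
    intro n hn z hz
    exact ⟨le_normalizer_iff.1 hNK n hn z hz.1, conj_mem_centralizer (hNK hn) hz.2⟩
  have hZN : Z ⊓ N = ⊥ := by
    refine hJ.eq_bot_of_le_normalizer_of_le_centralizer ht (N := N) inf_le_right ?_ ?_
    · rw [le_normalizer_iff]
      exact fun n hn z hz => ⟨hNZ n hn z hz.1, hNn.conj_mem z hz.2 n⟩
    · exact inf_le_left.trans (inf_le_right.trans (centralizer_le (inf_le_left.trans inf_le_left)))
  have : Nontrivial K := nontrivial_iff_ne_bot K |>.2 hK
  obtain ⟨z, hz, hz1⟩ :=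
    (center K).bot_or_exists_ne_one.resolve_left (Group.IsNilpotent.center_ne_bot K)
  have hzZ : (z : G) ∈ Z := by
    refine ⟨z.2, mem_centralizer_iff.2 fun k hk => ?_⟩
    exact congrArg Subtype.val (mem_center_iff.1 hz ⟨k, hk⟩)
  refine hz1 (Subtype.ext (hJ.eq_one_of_finiteIndex_centralizer ht
    (finiteIndex_of_le (H := N) ?_)))
  intro n hn
  rw [mem_centralizer_singleton_iff]
  have h1 : n * z * n⁻¹ * (z : G)⁻¹ ∈ Z ⊓ N := by
    refine ⟨Z.mul_mem (hNZ n hn z hzZ) (Z.inv_mem hzZ), ?_⟩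
    have := N.mul_mem hn (hNn.conj_mem _ (N.inv_mem hn) (z : G))
    simpa [mul_assoc] using this
  rw [hZN, mem_bot, mul_inv_eq_one, mul_inv_eq_iff_eq_mul] at h1
  exact h1

end JustInfinite

/-! ### Divisibility of indices in `p`-groups -/

lemma prodIndex_eq_relIndex {G : Type*} [Group G] (H K : Subgroup G) :
    prodIndex H K = H.relIndex K := by
  have hs : MulAction.stabilizer K (QuotientGroup.mk 1 : G ⧸ H) = H.subgroupOf K := by
    ext k
    rw [MulAction.mem_stabilizer_iff, mem_subgroupOf]
    change QuotientGroup.mk ((k : G) * 1) = _ ↔ _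
    rw [eq_comm, QuotientGroup.eq]
    simp
  rw [relIndex, ← hs, MulAction.index_stabilizer, prodIndex]
  congr 1
  ext c
  constructor
  · rintro ⟨k, hk, rfl⟩
    exact ⟨⟨k, hk⟩, congrArg QuotientGroup.mk (mul_one k)⟩
  · rintro ⟨k, rfl⟩
    exact ⟨k, k.2, congrArg QuotientGroup.mk (mul_one (k : G)).symm⟩

/-- In a `p`-group both indices are powers of `p`, so divisibility follows from comparing sizes. -/
lemma IsPGroup.relIndex_dvd_index {G : Type*} [Group G] {p : ℕ} [Fact p.Prime]
    (hG : IsPGroup p G) (H K : Subgroup G) [H.FiniteIndex] : H.relIndex K ∣ H.index := by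
  obtain ⟨m, hm⟩ := hG.index H
  obtain ⟨n, hn⟩ := (hG.to_subgroup K).index (H.subgroupOf K)
  have hle : H.relIndex K ≤ H.index := by
    simpa using relIndex_le_of_le_right (H := H) (le_top : K ≤ ⊤) (by
      simpa using FiniteIndex.index_ne_zero)
  rw [relIndex, hn, hm] at hle ⊢
  exact Nat.pow_dvd_pow p ((Nat.pow_le_pow_iff_right (Fact.out : p.Prime).one_lt).1 hle)

lemma IsPGroup.pow_index_mem {G : Type*} [Group G] {p : ℕ} [Fact p.Prime]
    (hG : IsPGroup p G) (H : Subgroup G) [H.FiniteIndex] (x : G) : x ^ H.index ∈ H := by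
  obtain ⟨k, hk⟩ := hG.relIndex_dvd_index H (zpowers x)
  have h := Subgroup.pow_index_mem (H.subgroupOf (zpowers x)) ⟨x, mem_zpowers x⟩
  rw [mem_subgroupOf] at h
  rw [hk, pow_mul]
  exact H.pow_mem h k

theorem lemma5p11 {G : Type*} [Group G] (p : ℕ) (hp : p.Prime)
    (hJ : IsJustInfinite G) (hG : IsPGroup p G) :
    sSet G = Set.univ ∧
    baerRadical G = {1} ∧
    (∀ K : Subgroup G, K ≠ ⊥ → Group.IsNilpotent K →
      (∀ H : Subgroup G, H.FiniteIndex → prodIndex H K ∣ H.index) ∧ ¬ K.IsSubnormal) := by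
  have := Fact.mk hp
  have ht : IsMulTorsion G := fun x => hG.isOfFinOrder hp.ne_zero x
  refine ⟨Set.eq_univ_of_forall fun x H _ => hG.pow_index_mem H x, ?_, fun K hK hnil =>
    ⟨fun H _ => prodIndex_eq_relIndex H K ▸ hG.relIndex_dvd_index H K,
      hJ.not_isSubnormal_of_isNilpotent ht hK hnil⟩⟩
  ext x
  rw [Set.mem_singleton_iff]
  constructor
  · intro hx
    by_contra hx1
    open scoped IsMulCommutative in
    exact hJ.not_isSubnormal_of_isNilpotent ht (zpowers_ne_bot.2 hx1) inferInstance hx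
  · rintro rfl
    change (zpowers (1 : G)).IsSubnormal
    simp
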